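/- Let $F,J$ be functions on $\mathbb R^n$ such that $J:\mathbb R^n\to(-\infty,+\infty]$ is proper, lower semicontinuous and convex, and $F:\mathbb R^n\to\mathbb R$ is convex and continuously differentiable with $\beta$-Lipschitz gradient, $\beta>0$. Let $x^\star$ be a minimizer of $\Phi=F+J$. For $x\in\mathbb R^n$ let $T_x$ be the orthogonal complement of the linear subspace parallel to the affine hull of the subdifferential $\partial J(x)$, and let $e_x$ be the single element of $P_{T_x}(\partial J(x))$ (generalized sign vector), where $P_{\mathcal C}$ denotes orthogonal projection onto $\mathcal C$. Recall that $J$ is *partly smooth at $x$ relative to a set* $\mathcal M\ni x$ if $\partial J(x)\ne\emptyset$, $\mathcal M$ is a $C^2$-manifold around $x$ and $J|_{\mathcal M}$ is $C^2$ around $x$, the tangent space of $\mathcal M$ at $x$ is $T_x$, and the set-valued map $\partial J$ is continuous (inner and outer semicontinuous) at $x$ relative to $\mathcal M$. Put $T=T_{x^\star}$. Assume: 1. $J$ is partly smooth at $x^\star$ relative to $\mathcal M$, where $\mathcal M=x^\star+T$ or $\mathcal M=T$, and there is a neighbourhood $U$ of $x^\star$ with $e_{x}=e_{x^\star}$ for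 all $x\in\mathcal M\cap U$; 2. (non-degeneracy) $-\nabla F(x^\star)$ lies in the relative interior of $\partial J(x^\star)$; 3. there are $\varepsilon>0$ and a linear subspace $V$ such that $F$ is $C^2$ on the ball $B_\varepsilon(x^\star)$ and $\ker\big(P_T\nabla^2F(x)P_T\big)=V$ for every $x\in B_\varepsilon(x^\star)$. Then: (a) there are $\alpha>0$ and $r>0$ such that $\langle d,P_T\nabla^2F(x)P_T\,d\rangle\ge\alpha\|d\|^2$ for all $d\in V^\perp$ and all $x\in B_r(x^\star)$; (b) for every $\alpha>0$ such that $\langle d,P_T\nabla^2F(x^\star)P_T\,d\rangle\ge\alpha\|d\|^2$ for all $d\in V^\perp$, and for every sequence $(x_k)$ that converges to $x^\star$ and is generated from an arbitrary $x_0\in\mathbb R^n$ by the Forward–Backward scheme $$x_{k+1}=\operatorname{prox}_{\gamma_kJ}\big(x_k-\gamma_k\nabla F(x_k)\big),\qquad \operatorname{prox}_{\gamma J}(u)=\operatorname*{argmin}_{z\in\mathbb R^n}\ \tfrac1{2\gamma}\|z-u\|^2+J(z),$$ with step sizes $0<\underline\gamma\le\gamma_k\le\overline\gamma<\min(2\alpha\beta^{-2},2\beta^{-1})$,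 there exist $C>0$ and $\rho\in[0,1)$ such that $\|x_k-x^\star\|\le C\rho^k$ for all $k$ large enough. -/

import Mathlib

open Set Filter Topology
open scoped NNReal

noncomputable section

namespace FB

/-- The space `ℝⁿ` with its Euclidean structure. -/
abbrev Eu (n : ℕ) : Type := EuclideanSpace ℝ (Fin n)

variable {n : ℕ}

/-- Proper, lower semicontinuous, convex functions `ℝⁿ → (-∞, +∞]`; convexity is convexity of the
epigraph. -/
structure ProperLscConvex (J : Eu n → EReal) : Prop where
  ne_bot : ∀ x, J x ≠ ⊥
  exists_ne_top : ∃ x, J x ≠ ⊤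
  lsc : LowerSemicontinuous J
  convex_epi : Convex ℝ {p : Eu n × ℝ | J p.1 ≤ (p.2 : EReal)}

/-- The convex subdifferential `∂J(x)`. For proper `J` it is empty when `J x = +∞`. -/
def subdiff (J : Eu n → EReal) (x : Eu n) : Set (Eu n) :=
  {v | ∀ z, J x + ((inner ℝ v (z - x) : ℝ) : EReal) ≤ J z}

/-- The tangent model subspace `T_x`: the orthogonal complement of the subspace parallel to the
affine hull of `∂J(x)`. -/
def modelSubspace (J : Eu n → EReal) (x : Eu n) : Submodule ℝ (Eu n) :=
  (vectorSpan ℝ (subdiff J x))ᗮ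

open Classical in
/-- The generalized sign vector `e_x`: the single element of `P_{T_x}(∂J(x))`
(the value is `0` by convention if `∂J(x)` is empty). -/
def signVector (J : Eu n → EReal) (x : Eu n) : Eu n :=
  if h : (subdiff J x).Nonempty then (modelSubspace J x).starProjection h.choose else 0

/-- `P_{T_x}(∂J(x))` is indeed single-valued, with value `e_x`. -/
theorem starProjection_eq_signVector (J : Eu n → EReal) (x v : Eu n) (hv : v ∈ subdiff J x) :
    (modelSubspace J x).starProjection v = signVector J x := by
  have h : (subdiff J x).Nonempty := ⟨v, hv⟩
  rw [signVector, dif_pos h, ← sub_eq_zero, ← map_sub]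
  apply Submodule.starProjection_apply_eq_zero_iff _ |>.2
  exact Submodule.le_orthogonal_orthogonal _ (vsub_mem_vectorSpan ℝ hv h.choose_spec)

/-- `M` is a `C²` (embedded) manifold around `x ∈ M`: near `x` it is the zero set of a `C²` map with
surjective derivative at `x`. -/
def IsC2ManifoldAround (M : Set (Eu n)) (x : Eu n) : Prop :=
  x ∈ M ∧ ∃ (m : ℕ) (g : Eu n → Eu m) (U : Set (Eu n)), IsOpen U ∧ x ∈ U ∧
    ContDiffOn ℝ 2 g U ∧ Function.Surjective (fderiv ℝ g x) ∧ M ∩ U = {y | y ∈ U ∧ g y = 0}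

/-- The tangent space of `M` at `x`: the velocities at `x` of the `C¹` curves in `M` through `x`. -/
def tangentVectors (M : Set (Eu n)) (x : Eu n) : Set (Eu n) :=
  {v | ∃ c : ℝ → Eu n, c 0 = x ∧ ContDiffAt ℝ 1 c 0 ∧ (∀ᶠ t in 𝓝 0, c t ∈ M) ∧ deriv c 0 = v}

/-- `J` restricted to `M` is `C²` around `x`: near `x` it agrees on `M` with a `C²` function. -/
def IsC2OnAround (J : Eu n → EReal) (M : Set (Eu n)) (x : Eu n) : Prop :=
  ∃ h : Eu n → ℝ, ContDiffAt ℝ 2 h x ∧ ∀ᶠ y in 𝓝[M] x, J y = (h y : EReal)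

/-- Continuity at `x` relative to `M` of a set-valued mapping, in the sense of Painlevé–Kuratowski:
inner semicontinuity together with outer semicontinuity. -/
def SetValuedContinuousAt (S : Eu n → Set (Eu n)) (M : Set (Eu n)) (x : Eu n) : Prop :=
  (∀ v ∈ S x, ∀ ε > 0, ∀ᶠ y in 𝓝[M] x, ∃ w ∈ S y, dist w v < ε) ∧
  (∀ v, (∀ ε > 0, ∃ᶠ y in 𝓝[M] x, ∃ w ∈ S y, dist w v < ε) → v ∈ S x)

/-- `J` is partly smooth at `x` relative to `M`. -/
structure PartlySmoothAt (J : Eu n → EReal) (x : Eu n) (M : Set (Eu n)) : Prop where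
  subdiff_nonempty : (subdiff J x).Nonempty
  manifold : IsC2ManifoldAround M x
  smooth : IsC2OnAround J M x
  sharp : tangentVectors M x = (modelSubspace J x : Set (Eu n))
  continuous : SetValuedContinuousAt (subdiff J) M x

/-- `J` is partly smooth at `x` relative to the affine space `x + T_x` or to the linear space `T_x`,
and the generalized sign vector is constant on that active manifold near `x`. -/
def PartlySmoothLocallyConstantSign (J : Eu n → EReal) (x : Eu n) : Prop :=
  ∃ M : Set (Eu n),
    (M = {y | y - x ∈ modelSubspace J x} ∨ M = (modelSubspace J x : Set (Eu n))) ∧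
    PartlySmoothAt J x M ∧
    ∃ U ∈ 𝓝 x, ∀ y ∈ M ∩ U, signVector J y = signVector J x

/-- `p = prox_{γJ}(u)`: `p` minimizes `z ↦ ‖z - u‖² / (2γ) + J(z)`. -/
def IsProx (γ : ℝ) (J : Eu n → EReal) (u p : Eu n) : Prop :=
  IsMinOn (fun z => ((1 / (2 * γ) * ‖z - u‖ ^ 2 : ℝ) : EReal) + J z) univ p

/-- `x` is generated by the Forward–Backward scheme
`x_{k+1} = prox_{γ_k J}(x_k - γ_k ∇F(x_k))`, from an arbitrary `x_0`. -/
def IsForwardBackward (F : Eu n → ℝ) (J : Eu n → EReal) (γ : ℕ → ℝ) (x : ℕ → Eu n) : Prop :=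
  ∀ k, IsProx (γ k) J (x k - γ k • gradient F (x k)) (x (k + 1))

/-- The Hessian `∇²F(x)` as a linear operator: the derivative of the gradient. -/
def hessian (F : Eu n → ℝ) (x : Eu n) : Eu n →L[ℝ] Eu n :=
  fderiv ℝ (gradient F) x

/-- The restricted Hessian `P_T ∇²F(x) P_T`. -/
def restrictedHessian (F : Eu n → ℝ) (T : Submodule ℝ (Eu n)) (x : Eu n) : Eu n →L[ℝ] Eu n :=
  T.starProjection ∘L hessian F x ∘L T.starProjection

/-- `⟨d, P_T ∇²F(x) P_T d⟩ ≥ α ‖d‖²` for all `d ∈ V^⊥`. -/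
def RestrictedHessianBound (F : Eu n → ℝ) (T V : Submodule ℝ (Eu n)) (α : ℝ) (x : Eu n) : Prop :=
  ∀ d ∈ Vᗮ, α * ‖d‖ ^ 2 ≤ inner ℝ d (restrictedHessian F T x d)

end FB

end

/-!
Write `T = T_{xs}`, `e = e_{xs}` and `r_k = x_k - xs`. A linear manifold `T` containing `xs` is
`xs + T`, so the active manifold is `xs + T` in either case. The proof reduces the Forward–Backward
iteration to a projected gradient iteration on `xs + T`, and then to one on `xs + Vᗮ`.

*Identification.* The proximal step provides subgradients `v_k ∈ ∂J(x_{k+1})` which tend to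
`-∇F(xs)`, a point of the relative interior of `∂J(xs)`. Were `x_{k+1}` off `xs + T`, with normal
displacement `q ∈ Tᗮ` from its projection `p` on `xs + T`, inner semicontinuity would give a
subgradient `w ∈ ∂J(p)` close to `-∇F(xs) + d`, where `d` is a short positive multiple of `q` of
fixed length, and `⟪v_k - w, q⟫ < 0` would contradict the monotonicity of `∂J`
(`FB.ProperLscConvex.eventually_sub_mem_modelSubspace`).

*Reduction to a gradient step.* On `xs + T` near `xs`, `J` is differentiable along `T`, so all
subgradients at a point have the same component along `T`, and local constancy of the sign vector
makes it `e` (`FB.eventually_starProjection_eq_signVector`). Projecting the proximal step on `T`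
yields `r_{k+1} = r_k - γ_k P_T(∇F(x_k) - ∇F(xs))`
(`FB.IsForwardBackward.eventually_sub_eq`).

*Removal of the kernel.* The restricted Hessians are symmetric with the same kernel `V`, so
`P_T(∇F(x_k) - ∇F(xs))` is orthogonal to `V` (`FB.inner_gradient_sub_eq_zero`). The `V`-component
of `r_k` is therefore eventually constant, and it tends to `0`; hence `r_k ∈ Vᗮ`.

*Contraction.* For `α' < α` and `g = P_T(∇F(x_k) - ∇F(xs))` one has `⟪r_k, g⟫ ≥ α' ‖r_k‖²`
near `xs`, while `‖g‖ ≤ β ‖r_k‖`. Hence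
`‖r_{k+1}‖² ≤ (1 - 2 γ_k α' + γ_k² β²) ‖r_k‖²`, and `α'` can be chosen so that the factor stays
below `1` uniformly in the admissible step sizes.

The bound of the restricted Hessian itself holds at `xs` by compactness of the unit sphere of
`Vᗮ`, on which a positive operator with kernel `V` has a positive quadratic form, and it extends to
a ball by continuity of the Hessian.
-/

namespace FB

variable {n : ℕ}

/-! ### Subdifferentials and proximal points -/

theorem ProperLscConvex.exists_real_of_mem_subdiff {J : Eu n → EReal} (hJ : ProperLscConvex J)
    {x v : Eu n} (hv : v ∈ subdiff J x) : ∃ a : ℝ, J x = (a : EReal) := by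
  obtain ⟨z, hz⟩ := hJ.exists_ne_top
  refine ⟨(J x).toReal, (EReal.coe_toReal (fun h => hz ?_) (hJ.ne_bot x)).symm⟩
  have := hv z
  rwa [h, EReal.top_add_coe, top_le_iff] at this

/-- Monotonicity of the subdifferential. -/
theorem ProperLscConvex.inner_sub_sub_nonneg {J : Eu n → EReal} (hJ : ProperLscConvex J)
    {x y v w : Eu n} (hv : v ∈ subdiff J x) (hw : w ∈ subdiff J y) :
    0 ≤ (inner ℝ (v - w) (x - y) : ℝ) := by
  obtain ⟨a, ha⟩ := hJ.exists_real_of_mem_subdiff hv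
  obtain ⟨b, hb⟩ := hJ.exists_real_of_mem_subdiff hw
  have h1 := hv y
  have h2 := hw x
  rw [ha, hb, ← EReal.coe_add, EReal.coe_le_coe_iff] at h1 h2
  simp only [inner_sub_left, inner_sub_right] at *
  linarith

/-- The optimality condition of the proximal step: `(u - p) / γ ∈ ∂J(p)` for `p = prox_{γJ}(u)`. -/
theorem IsProx.smul_sub_mem_subdiff {J : Eu n → EReal} (hJ : ProperLscConvex J) {γ : ℝ}
    (hγ : 0 < γ) {u p : Eu n} (h : IsProx γ J u p) : γ⁻¹ • (u - p) ∈ subdiff J p := by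
  have hmin : ∀ z, ((1 / (2 * γ) * ‖p - u‖ ^ 2 : ℝ) : EReal) + J p
      ≤ ((1 / (2 * γ) * ‖z - u‖ ^ 2 : ℝ) : EReal) + J z := fun z => h (mem_univ z)
  have htop : J p ≠ ⊤ := by
    intro hp
    obtain ⟨z, hz⟩ := hJ.exists_ne_top
    have := hmin z
    rw [hp, EReal.coe_add_top, top_le_iff] at this
    lift J z to ℝ using ⟨hz, hJ.ne_bot z⟩ with b
    exact EReal.coe_ne_top _ this
  intro z
  by_cases hz : J z = ⊤
  · rw [hz]; exact le_top
  obtain ⟨a, ha⟩ : ∃ a : ℝ, J p = a := ⟨_, (EReal.coe_toReal htop (hJ.ne_bot p)).symm⟩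
  obtain ⟨b, hb⟩ : ∃ b : ℝ, J z = b := ⟨_, (EReal.coe_toReal hz (hJ.ne_bot z)).symm⟩
  rw [ha, hb, ← EReal.coe_add, EReal.coe_le_coe_iff]
  -- comparison of `p` with the point `p + t (z - p)` of the segment from `p` to `z`
  have key : ∀ t ∈ Ioo (0 : ℝ) 1,
      a + inner ℝ (γ⁻¹ • (u - p)) (z - p) ≤ b + t * (1 / (2 * γ) * ‖z - p‖ ^ 2) := by
    intro t ht
    have hc : J (p + t • (z - p)) ≤ ((a + t * (b - a) : ℝ) : EReal) := by
      have := hJ.convex_epi (x := (p, a)) (by simp [ha]) (y := (z, b)) (by simp [hb])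
        (a := 1 - t) (b := t) (by linarith [ht.2]) ht.1.le (by ring)
      simp only [mem_ofPred_eq, Prod.smul_mk, Prod.mk_add_mk, smul_eq_mul] at this
      convert this using 2
      · module
      · ring
    have h1 := (hmin (p + t • (z - p))).trans (add_le_add_right hc _)
    rw [ha, ← EReal.coe_add, ← EReal.coe_add, EReal.coe_le_coe_iff,
      show p + t • (z - p) - u = t • (z - p) - (u - p) by module, norm_sub_rev p u,
      norm_sub_sq_real (t • (z - p)), norm_smul, inner_smul_left, Real.norm_of_nonneg ht.1.le] at h1
    rw [inner_smul_left, real_inner_comm]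
    simp only [RCLike.conj_to_real] at *
    have h2 : t * (a + γ⁻¹ * inner ℝ (z - p) (u - p))
        ≤ t * (b + t * (1 / (2 * γ) * ‖z - p‖ ^ 2)) := by
      have : 1 / (2 * γ) * ((t * ‖z - p‖) ^ 2 - 2 * (t * inner ℝ (z - p) (u - p)) + ‖u - p‖ ^ 2)
          = t * (t * (1 / (2 * γ) * ‖z - p‖ ^ 2)) - t * (γ⁻¹ * inner ℝ (z - p) (u - p))
            + 1 / (2 * γ) * ‖u - p‖ ^ 2 := by
        field_simp
      rw [this] at h1
      linarith
    exact le_of_mul_le_mul_left h2 ht.1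
  have hlim : Tendsto (fun t : ℝ => b + t * (1 / (2 * γ) * ‖z - p‖ ^ 2)) (𝓝[>] 0) (𝓝 b) := by
    have : Continuous fun t : ℝ => b + t * (1 / (2 * γ) * ‖z - p‖ ^ 2) := by fun_prop
    simpa using (this.tendsto 0).mono_left nhdsWithin_le_nhds
  refine ge_of_tendsto hlim ?_
  filter_upwards [Ioo_mem_nhdsGT (zero_lt_one (α := ℝ))] with t ht using key t ht

/-- A point of the relative interior is the centre of a ball of the affine hull contained in the
set. -/
theorem exists_add_mem_of_mem_intrinsicInterior {s : Set (Eu n)} {v : Eu n}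
    (hv : v ∈ intrinsicInterior ℝ s) :
    ∃ δ > 0, ∀ d ∈ vectorSpan ℝ s, ‖d‖ < δ → v + d ∈ s := by
  obtain ⟨y, hy, rfl⟩ := mem_intrinsicInterior.1 hv
  obtain ⟨δ, hδ, hball⟩ := Metric.mem_nhds_iff.1 (mem_interior_iff_mem_nhds.1 hy)
  refine ⟨δ, hδ, fun d hd hdδ => ?_⟩
  rw [← direction_affineSpan] at hd
  have hmem : (y : Eu n) + d ∈ affineSpan ℝ s := by
    simpa [add_comm] using AffineSubspace.vadd_mem_of_mem_direction hd y.2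
  have : (⟨(y : Eu n) + d, hmem⟩ : affineSpan ℝ s) ∈ Metric.ball y δ := by
    simpa [Metric.mem_ball, Subtype.dist_eq, dist_eq_norm] using hdδ
  exact hball this

theorem vectorSpan_eq_modelSubspace_orthogonal (J : Eu n → EReal) (x : Eu n) :
    vectorSpan ℝ (subdiff J x) = (modelSubspace J x)ᗮ :=
  (Submodule.orthogonal_orthogonal _).symm

/-! ### Identification of the active manifold -/

/-- Inner semicontinuity is uniform over the compact subsets of the limit set. -/
theorem SetValuedContinuousAt.eventually_forall_mem {S : Eu n → Set (Eu n)} {M : Set (Eu n)}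
    {x : Eu n} (h : SetValuedContinuousAt S M x) {K : Set (Eu n)} (hK : IsCompact K)
    (hKS : K ⊆ S x) {ε : ℝ} (hε : 0 < ε) :
    ∀ᶠ y in 𝓝[M] x, ∀ v ∈ K, ∃ w ∈ S y, dist w v < ε := by
  obtain ⟨t, htK, ht, hcov⟩ := hK.finite_cover_balls (half_pos hε)
  have : ∀ᶠ y in 𝓝[M] x, ∀ v ∈ t, ∃ w ∈ S y, dist w v < ε / 2 :=
    (eventually_all_finite ht).2 fun v hv => h.1 v (hKS (htK hv)) _ (half_pos hε)
  filter_upwards [this] with y hy v hv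
  obtain ⟨v', hv', hd⟩ := mem_iUnion₂.1 (hcov hv)
  obtain ⟨w, hw, hwd⟩ := hy v' hv'
  refine ⟨w, hw, ?_⟩
  have := dist_triangle_right w v v'
  rw [Metric.mem_ball] at hd
  linarith

/-- Finite identification: if `x_k → x`, `v_k ∈ ∂J(x_k)` and `v_k` tends to a point of the relative
interior of `∂J(x)`, then `x_k` eventually lies in the affine manifold `x + T_x`. -/
theorem ProperLscConvex.eventually_sub_mem_modelSubspace {J : Eu n → EReal}
    (hJ : ProperLscConvex J) {x vs : Eu n}
    (hcont : SetValuedContinuousAt (subdiff J) {y | y - x ∈ modelSubspace J x} x)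
    (hvs : vs ∈ intrinsicInterior ℝ (subdiff J x)) {y v : ℕ → Eu n}
    (hy : Tendsto y atTop (𝓝 x)) (hv : Tendsto v atTop (𝓝 vs))
    (hvy : ∀ᶠ k in atTop, v k ∈ subdiff J (y k)) :
    ∀ᶠ k in atTop, y k - x ∈ modelSubspace J x := by
  set T := modelSubspace J x with hT
  obtain ⟨δ, hδ, hball⟩ := exists_add_mem_of_mem_intrinsicInterior hvs
  rw [vectorSpan_eq_modelSubspace_orthogonal, ← hT] at hball
  -- the sphere of radius `δ / 2` about `vs` in the affine hull of `∂J(x)`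
  set K : Set (Eu n) := (fun d => vs + d) '' (Metric.sphere 0 (δ / 2) ∩ (Tᗮ : Set (Eu n)))
  have hK : IsCompact K :=
    ((isCompact_sphere _ _).inter_right (Submodule.closed_of_finiteDimensional _)).image
      (by fun_prop)
  have hKJ : K ⊆ subdiff J x := by
    rintro _ ⟨d, ⟨hd, hdT⟩, rfl⟩
    refine hball d hdT ?_
    rw [mem_sphere_zero_iff_norm.1 hd]
    linarith
  have hunif := hcont.eventually_forall_mem hK hKJ (show 0 < δ / 4 by linarith)
  -- the projections of the `y k` on the manifold
  have hp : Tendsto (fun k => x + T.starProjection (y k - x)) atTop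
      (𝓝[{y | y - x ∈ T}] x) := by
    refine tendsto_nhdsWithin_iff.2 ⟨?_, Eventually.of_forall fun k => ?_⟩
    · have : Continuous fun z => x + T.starProjection (z - x) := by fun_prop
      simpa [Function.comp_def] using (this.tendsto x).comp hy
    · rw [mem_ofPred_eq, add_sub_cancel_left]
      exact T.starProjection_apply_mem _
  have hv' : ∀ᶠ k in atTop, dist (v k) vs < δ / 4 :=
    hv (Metric.ball_mem_nhds _ (by linarith))
  filter_upwards [hp.eventually hunif, hv', hvy] with k hk1 hk2 hk3
  set q := y k - x - T.starProjection (y k - x) with hq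
  have hqT : q ∈ Tᗮ := T.sub_starProjection_mem_orthogonal _
  by_contra hne
  have hq0 : 0 < ‖q‖ := by
    rw [norm_pos_iff, hq, sub_ne_zero]
    exact fun h => hne (Submodule.starProjection_eq_self_iff.1 h.symm)
  set d := (δ / 2 / ‖q‖) • q with hd
  have hdn : ‖d‖ = δ / 2 := by
    rw [hd, norm_smul, Real.norm_of_nonneg (by positivity), div_mul_cancel₀ _ hq0.ne']
  obtain ⟨w, hw, hwd⟩ := hk1 (vs + d) ⟨d, ⟨by simpa using hdn, Tᗮ.smul_mem _ hqT⟩, rfl⟩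
  have hmono := hJ.inner_sub_sub_nonneg hk3 hw
  rw [show y k - (x + T.starProjection (y k - x)) = q by rw [hq]; abel] at hmono
  have h1 : (inner ℝ (v k - vs) q : ℝ) ≤ δ / 4 * ‖q‖ :=
    (real_inner_le_norm _ _).trans
      (mul_le_mul_of_nonneg_right (by rw [← dist_eq_norm]; exact hk2.le) hq0.le)
  have h2 : (inner ℝ (vs + d - w) q : ℝ) < δ / 4 * ‖q‖ :=
    (real_inner_le_norm _ _).trans_lt
      (mul_lt_mul_of_pos_right (by rw [← dist_eq_norm, dist_comm]; exact hwd) hq0)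
  have h3 : (inner ℝ d q : ℝ) = δ / 2 * ‖q‖ := by
    rw [hd, inner_smul_left, real_inner_self_eq_norm_sq]
    simp only [RCLike.conj_to_real]
    field_simp
  have h4 : (inner ℝ (v k - w) q : ℝ)
      = inner ℝ (v k - vs) q + inner ℝ (vs + d - w) q - inner ℝ d q := by
    rw [← inner_add_left, ← inner_sub_left]
    congr 1
    abel
  linarith

/-- Near `x` on the manifold `x + T_x`, the restriction of `J` is differentiable, which fixes the
component along `T_x` of every subgradient. Hence `T_x ≤ T_y`, and that component is `e_x` when the
generalized sign vector is locally constant. -/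
theorem eventually_starProjection_eq_signVector {J : Eu n → EReal} {x : Eu n}
    (hne : (subdiff J x).Nonempty)
    (hsm : IsC2OnAround J {y | y - x ∈ modelSubspace J x} x)
    (hsign : ∀ᶠ y in 𝓝[{y | y - x ∈ modelSubspace J x}] x, signVector J y = signVector J x) :
    ∀ᶠ y in 𝓝[{y | y - x ∈ modelSubspace J x}] x, ∀ w ∈ subdiff J y,
      (modelSubspace J x).starProjection w = signVector J x := by
  set T := modelSubspace J x with hT
  obtain ⟨h, hh, hJh⟩ := hsm
  have hdiff : ∀ᶠ y in 𝓝[{y | y - x ∈ T}] x, DifferentiableAt ℝ h y :=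
    ((hh.eventually (by simp)).mono fun y hy => hy.differentiableAt two_ne_zero).filter_mono
      nhdsWithin_le_nhds
  filter_upwards [eventually_eventually_nhdsWithin.2 hJh, hdiff, hsign, self_mem_nhdsWithin]
    with y hy hdy hsy hyT w hw
  have hyself : J y = (h y : EReal) := hy.self_of_nhdsWithin hyT
  have hderiv : ∀ w' ∈ subdiff J y, ∀ d ∈ T, (inner ℝ w' d : ℝ) = fderiv ℝ h y d := by
    intro w' hw' d hd
    have hcurve : Tendsto (fun t : ℝ => y + t • d) (𝓝 0) (𝓝[{y | y - x ∈ T}] y) := by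
      refine tendsto_nhdsWithin_iff.2 ⟨?_, Eventually.of_forall fun t => ?_⟩
      · have : Continuous fun t : ℝ => y + t • d := by fun_prop
        simpa using this.tendsto 0
      · rw [mem_ofPred_eq, add_sub_right_comm]
        exact T.add_mem hyT (T.smul_mem _ hd)
    have hmin : IsLocalMin (fun t : ℝ => h (y + t • d) - t * inner ℝ w' d) 0 := by
      filter_upwards [hcurve.eventually hy] with t ht
      have := hw' (y + t • d)
      rw [hyself, ht, ← EReal.coe_add, EReal.coe_le_coe_iff, add_sub_cancel_left,
        inner_smul_right] at this
      simp only [zero_smul, add_zero, zero_mul, sub_zero]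
      linarith
    have hline : HasDerivAt (fun t : ℝ => y + t • d) d 0 := by
      simpa using ((hasDerivAt_id (0 : ℝ)).smul_const d).const_add y
    have hd1 : HasDerivAt (fun t : ℝ => h (y + t • d)) (fderiv ℝ h y d) 0 := by
      have : HasFDerivAt h (fderiv ℝ h y) (y + (0 : ℝ) • d) := by simpa using hdy.hasFDerivAt
      exact this.comp_hasDerivAt 0 hline
    have hd2 := hd1.sub ((hasDerivAt_id (0 : ℝ)).mul_const (inner ℝ w' d : ℝ))
    have := hmin.hasDerivAt_eq_zero hd2
    linarith
  have hle : T ≤ modelSubspace J y := by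
    intro d hd
    rw [modelSubspace, Submodule.mem_orthogonal, vectorSpan_def]
    intro u hu
    induction hu using Submodule.span_induction with
    | mem u hu =>
      obtain ⟨a, ha, b, hb, rfl⟩ := Set.mem_vsub.1 hu
      rw [vsub_eq_sub, inner_sub_left, hderiv a ha d hd, hderiv b hb d hd, sub_self]
    | zero => exact inner_zero_left _
    | add a b _ _ ha hb => rw [inner_add_left, ha, hb, add_zero]
    | smul c a _ ha => rw [inner_smul_left, ha, mul_zero]
  obtain ⟨v, hv⟩ := hne
  have he : signVector J x ∈ T := by
    rw [← starProjection_eq_signVector J x v hv]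
    exact Submodule.starProjection_apply_mem _ _
  rw [← Submodule.starProjection_eq_self_iff.2 he, ← hsy, ← starProjection_eq_signVector J y w hw]
  exact (DFunLike.congr_fun (Submodule.starProjection_comp_starProjection_of_le hle) w).symm

/-! ### The gradient and the Hessian of a smooth convex function -/

theorem gradient_eq_toDual_symm_comp (F : Eu n → ℝ) :
    gradient F = fun x => (InnerProductSpace.toDual ℝ (Eu n)).symm (fderiv ℝ F x) := rfl

theorem contDiffOn_gradient {F : Eu n → ℝ} {s : Set (Eu n)} (hs : IsOpen s)
    (hF : ContDiffOn ℝ 2 F s) : ContDiffOn ℝ 1 (gradient F) s := by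
  rw [gradient_eq_toDual_symm_comp]
  exact (InnerProductSpace.toDual ℝ (Eu n)).symm.contDiff.comp_contDiffOn
    (hF.fderiv_of_isOpen hs (by norm_num))

theorem hasFDerivAt_gradient {F : Eu n → ℝ} {s : Set (Eu n)} (hs : IsOpen s)
    (hF : ContDiffOn ℝ 2 F s) {x : Eu n} (hx : x ∈ s) :
    HasFDerivAt (gradient F) (hessian F x) x :=
  (((contDiffOn_gradient hs hF).contDiffAt (hs.mem_nhds hx)).differentiableAt
    one_ne_zero).hasFDerivAt

theorem continuousOn_hessian {F : Eu n → ℝ} {s : Set (Eu n)} (hs : IsOpen s)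
    (hF : ContDiffOn ℝ 2 F s) : ContinuousOn (hessian F) s :=
  (contDiffOn_gradient hs hF).continuousOn_fderiv_of_isOpen hs le_rfl

/-- The gradient of a convex differentiable function is monotone. -/
theorem inner_gradient_sub_nonneg {F : Eu n → ℝ} (hconv : ConvexOn ℝ univ F)
    (hF : Differentiable ℝ F) (x y : Eu n) :
    0 ≤ (inner ℝ (gradient F y - gradient F x) (y - x) : ℝ) := by
  have key : ∀ x y : Eu n, (inner ℝ (gradient F x) (y - x) : ℝ) ≤ F y - F x := by
    intro x y
    have hc : ConvexOn ℝ univ (fun t : ℝ => F (AffineMap.lineMap x y t)) := by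
      simpa [Function.comp_def] using hconv.comp_affineMap (AffineMap.lineMap (k := ℝ) x y)
    have hd : HasDerivAt (fun t : ℝ => F (AffineMap.lineMap x y t)) (fderiv ℝ F x (y - x)) 0 := by
      have : HasFDerivAt F (fderiv ℝ F x) (AffineMap.lineMap x y (0 : ℝ)) := by
        simpa using (hF x).hasFDerivAt
      exact this.comp_hasDerivAt 0 AffineMap.hasDerivAt_lineMap
    have := hc.le_slope_of_hasDerivAt (mem_univ 0) (mem_univ 1) one_pos hd
    simpa [slope_def_field, inner_gradient_left] using this
  have h1 := key x y
  have h2 := key y x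
  rw [← neg_sub y x, inner_neg_right] at h2
  rw [inner_sub_left]
  linarith

theorem isPositive_hessian {F : Eu n → ℝ} (hconv : ConvexOn ℝ univ F)
    (hF : Differentiable ℝ F) {s : Set (Eu n)} (hs : IsOpen s) (hF2 : ContDiffOn ℝ 2 F s)
    {x : Eu n} (hx : x ∈ s) : (hessian F x).IsPositive := by
  have hG := hasFDerivAt_gradient hs hF2 hx
  rw [ContinuousLinearMap.isPositive_iff]
  constructor
  · have hsymm : IsSymmSndFDerivAt ℝ F x :=
      (hF2.contDiffAt (hs.mem_nhds hx)).isSymmSndFDerivAt (by simp)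
    have hval : ∀ v w, (inner ℝ (hessian F x v) w : ℝ) = fderiv ℝ (fderiv ℝ F) x v w := by
      intro v w
      have : HasFDerivAt (fderiv ℝ F)
          ((InnerProductSpace.toDual ℝ (Eu n)).toContinuousLinearEquiv.toContinuousLinearMap ∘L
            hessian F x) x := by
        have h1 := (InnerProductSpace.toDual ℝ
          (Eu n)).toContinuousLinearEquiv.toContinuousLinearMap.hasFDerivAt.comp x hG
        rw [← toDual_comp_gradient (𝕜 := ℝ)]
        exact h1
      rw [this.fderiv]
      simp
    intro v w
    simp only [ContinuousLinearMap.coe_coe]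
    rw [hval, real_inner_comm, hval]
    exact hsymm v w
  · intro d
    have hline : HasDerivAt (fun t : ℝ => x + t • d) d 0 := by
      simpa using ((hasDerivAt_id (0 : ℝ)).smul_const d).const_add x
    have hd1 : HasDerivAt (fun t : ℝ => gradient F (x + t • d)) (hessian F x d) 0 := by
      have : HasFDerivAt (gradient F) (hessian F x) (x + (0 : ℝ) • d) := by simpa using hG
      exact this.comp_hasDerivAt 0 hline
    have hd2 : HasDerivAt (fun t : ℝ => (inner ℝ (gradient F (x + t • d)) d : ℝ))
        (inner ℝ (hessian F x d) d) 0 := by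
      simpa using hd1.inner ℝ (hasDerivAt_const (0 : ℝ) d)
    have hmono : Monotone fun t : ℝ => (inner ℝ (gradient F (x + t • d)) d : ℝ) := by
      intro a b hab
      rcases hab.eq_or_lt with rfl | hab
      · exact le_rfl
      have := inner_gradient_sub_nonneg hconv hF (x + a • d) (x + b • d)
      rw [show x + b • d - (x + a • d) = (b - a) • d by module, inner_smul_right,
        inner_sub_left] at this
      have := nonneg_of_mul_nonneg_right this (sub_pos.2 hab)
      simp only
      linarith
    rw [← hd2.deriv]
    exact hmono.deriv_nonneg

theorem inner_restrictedHessian (F : Eu n → ℝ) (T : Submodule ℝ (Eu n)) (x d d' : Eu n) :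
    (inner ℝ d (restrictedHessian F T x d') : ℝ)
      = inner ℝ (T.starProjection d) (hessian F x (T.starProjection d')) := by
  rw [restrictedHessian, Submodule.inner_starProjection_left_eq_right]
  rfl

/-- A positive operator on a finite-dimensional space is bounded below on the orthogonal complement
of its kernel. -/
theorem exists_pos_forall_le_inner_of_isPositive {A : Eu n →L[ℝ] Eu n} (hA : A.IsPositive)
    {V : Submodule ℝ (Eu n)} (hV : LinearMap.ker A.toLinearMap = V) :
    ∃ α > 0, ∀ d ∈ Vᗮ, α * ‖d‖ ^ 2 ≤ inner ℝ d (A d) := by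
  set K : Set (Eu n) := Metric.sphere 0 1 ∩ (Vᗮ : Set (Eu n)) with hK
  have hKc : IsCompact K :=
    (isCompact_sphere _ _).inter_right (Submodule.closed_of_finiteDimensional _)
  have hpos : ∀ d ∈ K, 0 < (inner ℝ d (A d) : ℝ) := by
    rintro d ⟨hd1, hdV⟩
    refine lt_of_le_of_ne (hA.inner_nonneg_right d) fun h0 => ?_
    -- the form vanishes at `d`, so that `d` minimizes it along every line, whence `A d = 0`
    have hzero : A d = 0 := by
      have hq : ∀ t : ℝ, 0 ≤ (inner ℝ (A (A d)) (A d) : ℝ) * (t * t)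
          + (2 * ‖A d‖ ^ 2) * t + 0 := by
        intro t
        have h1 := hA.inner_nonneg_right (d + t • A d)
        have h2 : (inner ℝ d (A (A d)) : ℝ) = ‖A d‖ ^ 2 := by
          rw [← hA.inner_left_eq_inner_right, real_inner_self_eq_norm_sq]
        rw [map_add, map_smul, inner_add_left, inner_add_right, inner_add_right, ← h0] at h1
        simp only [inner_smul_left, inner_smul_right, h2, real_inner_self_eq_norm_sq,
          RCLike.conj_to_real] at h1
        rw [real_inner_comm]
        linarith
      have := discrim_le_zero hq
      rw [discrim, mul_zero, sub_zero] at this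
      have h3 : 2 * ‖A d‖ ^ 2 = 0 := pow_eq_zero_iff two_ne_zero |>.1
        (le_antisymm this (sq_nonneg _))
      simpa using h3
    have hdV' : d ∈ V := by rw [← hV]; exact hzero
    have : d = 0 := by
      simpa using Submodule.inner_right_of_mem_orthogonal hdV' hdV
    simp [this] at hd1
  have hform : Continuous fun d : Eu n => (inner ℝ d (A d) : ℝ) := by fun_prop
  obtain ⟨α, hα, hle⟩ : ∃ α > 0, ∀ d ∈ K, α ≤ (inner ℝ d (A d) : ℝ) := by
    rcases K.eq_empty_or_nonempty with h | h
    · exact ⟨1, one_pos, by simp [h]⟩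
    · obtain ⟨d₀, hd₀, hm⟩ := hKc.exists_isMinOn h hform.continuousOn
      exact ⟨_, hpos d₀ hd₀, fun d hd => hm hd⟩
  refine ⟨α, hα, fun d hd => ?_⟩
  rcases eq_or_ne d 0 with rfl | hd0
  · simp
  have hn : 0 < ‖d‖ := norm_pos_iff.2 hd0
  have := hle (‖d‖⁻¹ • d) ⟨by simp [norm_smul, hn.ne'], Vᗮ.smul_mem _ hd⟩
  rw [map_smul, inner_smul_left, inner_smul_right, ← mul_assoc] at this
  simp only [RCLike.conj_to_real] at this
  calc α * ‖d‖ ^ 2 ≤ ‖d‖⁻¹ * ‖d‖⁻¹ * inner ℝ d (A d) * ‖d‖ ^ 2 := by gcongr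
    _ = inner ℝ d (A d) := by field_simp

theorem continuousAt_restrictedHessian {F : Eu n → ℝ} {s : Set (Eu n)} (hs : IsOpen s)
    (hF : ContDiffOn ℝ 2 F s) (T : Submodule ℝ (Eu n)) {x : Eu n} (hx : x ∈ s) :
    ContinuousAt (restrictedHessian F T) x := by
  have := (continuousOn_hessian hs hF).continuousAt (hs.mem_nhds hx)
  unfold restrictedHessian
  fun_prop

/-- The lower bound of the restricted Hessian persists nearby, with any smaller constant. -/
theorem RestrictedHessianBound.eventually {F : Eu n → ℝ} {T V : Submodule ℝ (Eu n)} {x : Eu n}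
    (hcont : ContinuousAt (restrictedHessian F T) x) {α α' : ℝ} (hα : α' < α)
    (h : RestrictedHessianBound F T V α x) :
    ∀ᶠ y in 𝓝 x, RestrictedHessianBound F T V α' y := by
  filter_upwards [hcont (Metric.ball_mem_nhds _ (sub_pos.2 hα))] with y hy d hd
  rw [mem_preimage, mem_ball_iff_norm] at hy
  have h1 := h d hd
  have h2 : |(inner ℝ d ((restrictedHessian F T y - restrictedHessian F T x) d) : ℝ)|
      ≤ (α - α') * ‖d‖ ^ 2 := by
    refine (abs_real_inner_le_norm _ _).trans ?_
    calc _ ≤ ‖d‖ * ((α - α') * ‖d‖) := by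
          gcongr
          exact (ContinuousLinearMap.le_opNorm _ _).trans (by gcongr)
      _ = (α - α') * ‖d‖ ^ 2 := by ring
  rw [sub_apply, inner_sub_right] at h2
  linarith [(abs_le.1 h2).1]

/-- The gradient increment between two points of the affine space `x + T` is, after projection on
`T`, orthogonal to the common kernel `V` of the restricted Hessians. -/
theorem inner_gradient_sub_eq_zero {F : Eu n → ℝ} {T V : Submodule ℝ (Eu n)} {s : Set (Eu n)}
    (hs : IsOpen s) (hsc : Convex ℝ s) (hF : ContDiffOn ℝ 2 F s)
    (hpos : ∀ y ∈ s, (restrictedHessian F T y).IsPositive)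
    (hker : ∀ y ∈ s, LinearMap.ker (restrictedHessian F T y).toLinearMap = V)
    {x y v : Eu n} (hx : x ∈ s) (hy : y ∈ s) (hxy : y - x ∈ T) (hv : v ∈ V) :
    (inner ℝ (T.starProjection (gradient F y - gradient F x)) v : ℝ) = 0 := by
  have hderiv : ∀ t ∈ Icc (0 : ℝ) 1,
      HasDerivAt (fun t : ℝ => (inner ℝ (gradient F (AffineMap.lineMap x y t))
        (T.starProjection v) : ℝ)) 0 t := by
    intro t ht
    have hz : AffineMap.lineMap x y t ∈ s := hsc.lineMap_mem hx hy ht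
    have h1 := (hasFDerivAt_gradient hs hF hz).comp_hasDerivAt t
      (AffineMap.hasDerivAt_lineMap (a := x) (b := y))
    have h2 := h1.inner ℝ (hasDerivAt_const t (T.starProjection v))
    have hv0 : restrictedHessian F T (AffineMap.lineMap x y t) v = 0 := by
      rw [← hker _ hz] at hv
      exact hv
    have h3 := (hpos _ hz).inner_left_eq_inner_right v (y - x)
    rw [hv0, inner_zero_left, inner_restrictedHessian,
      Submodule.starProjection_eq_self_iff.2 hxy, real_inner_comm] at h3
    rwa [inner_zero_right, zero_add, ← h3] at h2
  have hconst := constant_of_has_deriv_right_zero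
    (fun t ht => (hderiv t ht).continuousAt.continuousWithinAt)
    (fun t ht => (hderiv t (Ico_subset_Icc_self ht)).hasDerivWithinAt) 1 (by simp)
  simp only [AffineMap.lineMap_apply_one, AffineMap.lineMap_apply_zero] at hconst
  rw [Submodule.inner_starProjection_left_eq_right, inner_sub_left, hconst, sub_self]

/-- Local strong monotonicity of the gradient along `Vᗮ`. -/
theorem eventually_mul_sq_le_inner_gradient_sub {F : Eu n → ℝ} {T V : Submodule ℝ (Eu n)}
    {x : Eu n} (hG : HasFDerivAt (gradient F) (hessian F x) x) {α α' : ℝ} (hα : α' < α)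
    (h : RestrictedHessianBound F T V α x) :
    ∀ᶠ y in 𝓝 x, y - x ∈ T → y - x ∈ Vᗮ →
      α' * ‖y - x‖ ^ 2 ≤ inner ℝ (y - x) (gradient F y - gradient F x) := by
  filter_upwards [hG.isLittleO.def (sub_pos.2 hα)] with y hy hyT hyV
  have h1 := h _ hyV
  rw [inner_restrictedHessian, Submodule.starProjection_eq_self_iff.2 hyT] at h1
  have h2 : |(inner ℝ (y - x) (gradient F y - gradient F x - hessian F x (y - x)) : ℝ)|
      ≤ (α - α') * ‖y - x‖ ^ 2 := by
    refine (abs_real_inner_le_norm _ _).trans ?_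
    calc _ ≤ ‖y - x‖ * ((α - α') * ‖y - x‖) := by gcongr
      _ = (α - α') * ‖y - x‖ ^ 2 := by ring
  rw [inner_sub_right] at h2
  linarith [(abs_le.1 h2).1]

/-! ### Linear convergence -/

/-- An eventually contracted sequence converges linearly. -/
theorem exists_linear_rate {u : ℕ → ℝ} {ρ : ℝ} (hρ : 0 < ρ)
    (h : ∀ᶠ k in atTop, u (k + 1) ≤ ρ * u k) : ∃ C > 0, ∀ᶠ k in atTop, u k ≤ C * ρ ^ k := by
  obtain ⟨K, hK⟩ := eventually_atTop.1 h
  refine ⟨|u K| / ρ ^ K + 1, by positivity, eventually_atTop.2 ⟨K, fun k hk => ?_⟩⟩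
  induction k, hk using Nat.le_induction with
  | base =>
    rw [add_mul, div_mul_cancel₀ _ (pow_pos hρ K).ne']
    linarith [le_abs_self (u K), pow_pos hρ K]
  | succ k hk ih =>
    calc u (k + 1) ≤ ρ * u k := hK k hk
      _ ≤ ρ * ((|u K| / ρ ^ K + 1) * ρ ^ k) := by gcongr
      _ = (|u K| / ρ ^ K + 1) * ρ ^ (k + 1) := by ring

/-- A gradient step is a contraction along directions of strong monotonicity. -/
theorem norm_sub_smul_sq_le {r g : Eu n} {α β γ γlo γhi : ℝ} (hγlo : 0 < γlo)
    (hlo : γlo ≤ γ) (hhi : γ ≤ γhi) (hstep : γhi * β ^ 2 < 2 * α)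
    (hα : α * ‖r‖ ^ 2 ≤ inner ℝ r g) (hg : ‖g‖ ≤ β * ‖r‖) :
    ‖r - γ • g‖ ^ 2 ≤ (1 - γlo * (2 * α - γhi * β ^ 2)) * ‖r‖ ^ 2 := by
  have hγ : 0 < γ := hγlo.trans_le hlo
  have hg2 : ‖g‖ ^ 2 ≤ β ^ 2 * ‖r‖ ^ 2 := by
    rw [← mul_pow]
    gcongr
  have hrate : γlo * (2 * α - γhi * β ^ 2) ≤ γ * (2 * α - γ * β ^ 2) := by
    have : γ * β ^ 2 ≤ γhi * β ^ 2 := by gcongr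
    exact mul_le_mul hlo (by linarith) (by linarith) hγ.le
  rw [norm_sub_sq_real, inner_smul_right, norm_smul, Real.norm_of_nonneg hγ.le]
  calc ‖r‖ ^ 2 - 2 * (γ * inner ℝ r g) + (γ * ‖g‖) ^ 2
      = ‖r‖ ^ 2 - 2 * (γ * inner ℝ r g) + γ ^ 2 * ‖g‖ ^ 2 := by ring
    _ ≤ ‖r‖ ^ 2 - 2 * (γ * (α * ‖r‖ ^ 2)) + γ ^ 2 * (β ^ 2 * ‖r‖ ^ 2) := by gcongr
    _ = (1 - γ * (2 * α - γ * β ^ 2)) * ‖r‖ ^ 2 := by ring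
    _ ≤ _ := by gcongr

/-- After identification of the manifold, the Forward–Backward iteration is the gradient iteration
projected on `T = T_{xs}`. -/
theorem IsForwardBackward.eventually_sub_eq {F : Eu n → ℝ} {J : Eu n → EReal} {γ : ℕ → ℝ}
    {x : ℕ → Eu n} (hFB : IsForwardBackward F J γ x) (hJ : ProperLscConvex J)
    (hgrad : Continuous (gradient F)) {xs : Eu n}
    (hPS : PartlySmoothLocallyConstantSign J xs)
    (hnondeg : -gradient F xs ∈ intrinsicInterior ℝ (subdiff J xs))
    {γlo : ℝ} (hγlo : 0 < γlo) (hγ : ∀ k, γlo ≤ γ k) (hx : Tendsto x atTop (𝓝 xs)) :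
    ∀ᶠ k in atTop, x k - xs ∈ modelSubspace J xs ∧ x (k + 1) - xs = x k - xs
      - γ k • (modelSubspace J xs).starProjection (gradient F (x k) - gradient F xs) := by
  set T := modelSubspace J xs with hT
  obtain ⟨M, hM, hPS, U, hU, hsign⟩ := hPS
  -- a linear manifold through `xs` is `xs + T` as well
  have hM' : M = {y | y - xs ∈ T} := by
    rcases hM with hM | hM
    · exact hM
    · have hxsT : xs ∈ T := by
        have := hPS.manifold.1
        rwa [hM] at this
      rw [hM]
      ext y
      exact (Submodule.sub_mem_iff_left T hxsT).symm
  subst hM'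
  have hsign' : ∀ᶠ y in 𝓝[{y | y - xs ∈ T}] xs, signVector J y = signVector J xs := by
    filter_upwards [self_mem_nhdsWithin, mem_nhdsWithin_of_mem_nhds hU] with y h1 h2
    exact hsign y ⟨h1, h2⟩
  have hγpos : ∀ k, 0 < γ k := fun k => hγlo.trans_le (hγ k)
  have hx1 : Tendsto (fun k => x (k + 1)) atTop (𝓝 xs) := (tendsto_add_atTop_iff_nat 1).2 hx
  -- the subgradients provided by the proximal steps
  set v : ℕ → Eu n := fun k => (γ k)⁻¹ • (x k - γ k • gradient F (x k) - x (k + 1)) with hv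
  have hvJ : ∀ k, v k ∈ subdiff J (x (k + 1)) := fun k =>
    (hFB k).smul_sub_mem_subdiff hJ (hγpos k)
  have hv' : ∀ k, v k = (γ k)⁻¹ • (x k - x (k + 1)) - gradient F (x k) := by
    intro k
    simp only [hv]
    rw [sub_right_comm, smul_sub, inv_smul_smul₀ (hγpos k).ne']
  have hvlim : Tendsto v atTop (𝓝 (-gradient F xs)) := by
    have h1 : Tendsto (fun k => (γ k)⁻¹ • (x k - x (k + 1))) atTop (𝓝 0) := by
      have h2 : Tendsto (fun k => γlo⁻¹ * ‖x k - x (k + 1)‖) atTop (𝓝 0) := by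
        simpa using (hx.sub hx1).norm.const_mul γlo⁻¹
      refine squeeze_zero_norm (fun k => ?_) h2
      rw [norm_smul, Real.norm_of_nonneg (inv_pos.2 (hγpos k)).le]
      gcongr
      exact hγ k
    rw [funext hv', ← zero_sub]
    exact h1.sub ((hgrad.tendsto xs).comp hx)
  have hid := hJ.eventually_sub_mem_modelSubspace hPS.continuous hnondeg hx1 hvlim
    (Eventually.of_forall hvJ)
  have hid0 : ∀ᶠ k in atTop, x k - xs ∈ T := by
    rwa [← map_add_atTop_eq_nat 1, eventually_map]
  have hproj := (tendsto_nhdsWithin_iff.2 ⟨hx1, hid⟩).eventually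
    (eventually_starProjection_eq_signVector hPS.subdiff_nonempty hPS.smooth hsign')
  filter_upwards [hid0, hid, hproj] with k hk hk1 hkp
  refine ⟨hk, ?_⟩
  have h1 := hkp _ (hvJ k)
  rw [← starProjection_eq_signVector J xs _ (intrinsicInterior_subset hnondeg), hv' k,
    show x k - x (k + 1) = (x k - xs) - (x (k + 1) - xs) by abel, ← hT, map_sub, map_smul,
    Submodule.starProjection_eq_self_iff.2 (T.sub_mem hk hk1), map_neg, sub_eq_iff_eq_add,
    neg_add_eq_sub, ← map_sub, inv_smul_eq_iff₀ (hγpos k).ne'] at h1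
  rw [← h1]
  abel

end FB

theorem mainTheorem2 {n : ℕ} (F : FB.Eu n → ℝ) (J : FB.Eu n → EReal) (β : ℝ≥0) (hβ : 0 < β)
    (hJ : FB.ProperLscConvex J)
    (hFconv : ConvexOn ℝ Set.univ F) (hFdiff : ContDiff ℝ 1 F)
    (hFlip : LipschitzWith β (gradient F))
    (xs : FB.Eu n) (hmin : IsMinOn (fun x => (F x : EReal) + J x) Set.univ xs)
    (hPS : FB.PartlySmoothLocallyConstantSign J xs)
    (hnondeg : -gradient F xs ∈ intrinsicInterior ℝ (FB.subdiff J xs))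
    (V : Submodule ℝ (FB.Eu n)) (ε : ℝ) (hε : 0 < ε)
    (hC2 : ContDiffOn ℝ 2 F (Metric.ball xs ε))
    (hker : ∀ x ∈ Metric.ball xs ε,
      LinearMap.ker (FB.restrictedHessian F (FB.modelSubspace J xs) x).toLinearMap = V) :
    (∃ α > 0, ∃ r > 0, ∀ x ∈ Metric.ball xs r,
      FB.RestrictedHessianBound F (FB.modelSubspace J xs) V α x) ∧
    ∀ α > 0, FB.RestrictedHessianBound F (FB.modelSubspace J xs) V α xs →
      ∀ (γlo γhi : ℝ) (γ : ℕ → ℝ) (x : ℕ → FB.Eu n),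
        0 < γlo → (∀ k, γlo ≤ γ k ∧ γ k ≤ γhi) →
        γhi < min (2 * α / (β : ℝ) ^ 2) (2 / (β : ℝ)) →
        FB.IsForwardBackward F J γ x → Tendsto x atTop (𝓝 xs) →
        ∃ C > 0, ∃ ρ : ℝ, 0 ≤ ρ ∧ ρ < 1 ∧ ∀ᶠ k in atTop, ‖x k - xs‖ ≤ C * ρ ^ k := by
  set T := FB.modelSubspace J xs with hT
  have hxs : xs ∈ Metric.ball xs ε := Metric.mem_ball_self hε
  have hpos : ∀ y ∈ Metric.ball xs ε, (FB.restrictedHessian F T y).IsPositive := fun y hy =>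
    (FB.isPositive_hessian hFconv (hFdiff.differentiable one_ne_zero) Metric.isOpen_ball hC2
      hy).conj_starProjection T
  constructor
  · obtain ⟨α, hα, hbound⟩ :=
      FB.exists_pos_forall_le_inner_of_isPositive (hpos xs hxs) (hker xs hxs)
    obtain ⟨r, hr, hball⟩ := Metric.eventually_nhds_iff_ball.1
      (FB.RestrictedHessianBound.eventually (FB.continuousAt_restrictedHessian
        Metric.isOpen_ball hC2 T hxs) (half_lt_self hα) hbound)
    exact ⟨α / 2, half_pos hα, r, hr, hball⟩
  intro α hα hbound γlo γhi γ x hγlo hγ hγhi hFB hx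
  have hβ' : (0 : ℝ) < β := hβ
  -- a constant `α' < α` for which the step sizes are still admissible
  obtain ⟨α', hα'1, hα'2⟩ : ∃ α', γhi * (β : ℝ) ^ 2 / 2 < α' ∧ α' < α := by
    refine exists_between ?_
    have := (lt_div_iff₀ (by positivity)).1 (hγhi.trans_le (min_le_left _ _))
    linarith
  have hstep : γhi * (β : ℝ) ^ 2 < 2 * α' := by linarith
  have hrec := hFB.eventually_sub_eq hJ hFlip.continuous hPS hnondeg hγlo (fun k => (hγ k).1) hx
  obtain ⟨K, hK⟩ := eventually_atTop.1 (hrec.and (hx (Metric.ball_mem_nhds xs hε)))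
  -- the `V`-component of `x k - xs` is stationary, hence equal to its limit `0`
  have hV : ∀ k ≥ K, x k - xs ∈ Vᗮ := by
    intro k hk v hv
    have hconst : ∀ j ≥ k, (inner ℝ v (x j - xs) : ℝ) = inner ℝ v (x k - xs) := by
      intro j hj
      induction j, hj using Nat.le_induction with
      | base => rfl
      | succ j hj ih =>
        obtain ⟨⟨hjT, hjrec⟩, hjb⟩ := hK j (hk.trans hj)
        rw [hjrec, inner_sub_right, inner_smul_right, real_inner_comm (T.starProjection _) v,
          FB.inner_gradient_sub_eq_zero Metric.isOpen_ball (convex_ball xs ε) hC2 hpos hker hxs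
            hjb hjT hv, mul_zero, sub_zero, ih]
    have hlim : Tendsto (fun j => (inner ℝ v (x j - xs) : ℝ)) atTop (𝓝 0) := by
      simpa using (tendsto_const_nhds (x := v)).inner (hx.sub_const xs)
    refine tendsto_nhds_unique (tendsto_const_nhds.congr' ?_) hlim
    filter_upwards [eventually_ge_atTop k] with j hj using (hconst j hj).symm
  -- the maximum keeps the rate positive
  set q : ℝ := max (1 / 2) (1 - γlo * (2 * α' - γhi * (β : ℝ) ^ 2)) with hq
  have hq0 : 0 < q := lt_max_of_lt_left (by norm_num)
  have hq1 : q < 1 :=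
    max_lt (by norm_num) (sub_lt_self _ (mul_pos hγlo (sub_pos.2 hstep)))
  have hcontr : ∀ᶠ k in atTop, ‖x (k + 1) - xs‖ ≤ √q * ‖x k - xs‖ := by
    filter_upwards [eventually_ge_atTop K, hx.eventually
      (FB.eventually_mul_sq_le_inner_gradient_sub
        (FB.hasFDerivAt_gradient Metric.isOpen_ball hC2 hxs) hα'2 hbound)] with k hk hmono
    obtain ⟨⟨hkT, hkrec⟩, -⟩ := hK k hk
    have h1 : α' * ‖x k - xs‖ ^ 2
        ≤ inner ℝ (x k - xs) (T.starProjection (gradient F (x k) - gradient F xs)) := by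
      rw [← Submodule.inner_starProjection_left_eq_right,
        Submodule.starProjection_eq_self_iff.2 hkT]
      exact hmono hkT (hV k hk)
    have h2 : ‖T.starProjection (gradient F (x k) - gradient F xs)‖ ≤ β * ‖x k - xs‖ :=
      (T.norm_starProjection_apply_le _).trans (hFlip.norm_sub_le _ _)
    have h3 := FB.norm_sub_smul_sq_le hγlo (hγ k).1 (hγ k).2 hstep h1 h2
    rw [← hkrec] at h3
    refine le_of_sq_le_sq ?_ (by positivity)
    rw [mul_pow, Real.sq_sqrt hq0.le]
    refine h3.trans ?_
    gcongr
    exact le_max_right _ _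
  obtain ⟨C, hC, hrate⟩ := FB.exists_linear_rate (u := fun k => ‖x k - xs‖)
    (Real.sqrt_pos.2 hq0) hcontr
  exact ⟨C, hC, √q, Real.sqrt_nonneg q, (Real.sqrt_lt_sqrt hq0.le hq1).trans_eq Real.sqrt_one,
    hrate⟩
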